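/- \textbf{Conventions.} An algebra is a structure in a language with finitary operations (of arbitrary number, constants allowed) and no relations. An algebra $F$ is \emph{relatively free} with basis $\mathcal B\subseteq F$ if it is a free algebra, freely generated by $\mathcal B$, of some variety of algebras (class defined by identities); its \emph{rank} is $|\mathcal B|$. A subset $J$ of an infinite set $I$ is a \emph{moiety} of $I$ if $|J|=|I\setminus J|$. Write $\langle X\rangle$ for the subalgebra generated by $X$, $\Gamma=\mathrm{Aut}(F)$, and $\Gamma_{(Y),\{Z\}}$ for the group of all $\sigma\in\Gamma$ that fix $Y$ pointwise and satisfy $\sigma(Z)=Z$. An automorphism $\sigma\in\Gamma$ is \emph{$\mathcal B$-moietous} if there is a partition $\mathcal B=\mathcal B_1\sqcup\mathcal B_2$ of $\mathcal B$ into moieties such that $\sigma\in\Gamma_{(\mathcal B_1),\{\langle\mathcal B_2\rangle\}}$. \textbf{Proposition.} Let $F$ be a relatively free algebra of infinite rank $\varkappa$ with basis $\mathcal B$, and let $\Sigma$ be a subgroup of $\Gamma=\mathrm{Aut}(F)$ of index at most $\varkappa$. Then there is a subset $\mathcal D\subseteq\mathcal B$ with $|\mathcal D|<\varkappa$ such that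 every $\mathcal B$-moietous automorphism of $F$ which fixes $\mathcal D$ pointwise belongs to $\Sigma$. In particular, for this $\mathcal D$ and every moiety $\mathcal C$ of $\mathcal B\setminus\mathcal D$, the stabilizer $\Gamma_{(\mathcal B\setminus\mathcal C),\{\langle\mathcal C\rangle\}}$ is contained in $\Sigma$. -/

import Mathlib

open Cardinal FirstOrder
open scoped Pointwise

universe u v w

namespace RelFree

open FirstOrder.Language

variable {L : FirstOrder.Language.{u, v}}

/-! ### The automorphism group of a structure -/

/-- The automorphism group `Aut F`, with `(σ * τ) x = σ (τ x)`. -/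
instance autGroup (F : Type w) [L.Structure F] : Group (F ≃[L] F) where
  mul σ τ := σ.comp τ
  one := FirstOrder.Language.Equiv.refl L F
  inv σ := σ.symm
  mul_assoc _ _ _ := rfl
  one_mul _ := FirstOrder.Language.Equiv.ext fun _ => rfl
  mul_one _ := FirstOrder.Language.Equiv.ext fun _ => rfl
  inv_mul_cancel σ := FirstOrder.Language.Equiv.ext fun x => σ.symm_apply_apply x

/-- The natural action of `Aut F` on `F`. -/
instance autMulAction (F : Type w) [L.Structure F] : MulAction (F ≃[L] F) F where
  smul σ x := σ x
  one_smul _ := rfl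
  mul_smul _ _ _ := rfl

theorem aut_smul_def {F : Type w} [L.Structure F] (σ : F ≃[L] F) (x : F) : σ • x = σ x := rfl

/-- `Γ_{(Y),{Z}}`: the automorphisms that fix `Y` pointwise and `Z` setwise. -/
def stab {F : Type w} [L.Structure F] (Y Z : Set F) : Subgroup (F ≃[L] F) :=
  fixingSubgroup (F ≃[L] F) Y ⊓ MulAction.stabilizer (F ≃[L] F) Z

/-! ### Varieties and relatively free algebras -/

/-- `M` lies in the variety defined by the set `E` of identities `s ≈ t`
(terms in countably many variables). -/
def InVariety (E : Set (L.Term ℕ × L.Term ℕ)) (M : Type w) [L.Structure M] : Prop :=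
  ∀ e ∈ E, ∀ x : ℕ → M, e.1.realize x = e.2.realize x

/-- `F` is a free algebra, with basis `B`, of the variety defined by `E`: it lies in the variety,
it is generated by `B`, and every map from `B` to an algebra `M` of the variety extends to a
homomorphism `F → M` (which is unique, as `B` generates `F`). Letting `M` run over the universe of
`F` only loses nothing: since `M = F` is allowed, `F` is then free on `B`, with respect to algebras
in all universes, in the variety defined by all identities of `F`. -/
structure IsFreeIn (E : Set (L.Term ℕ × L.Term ℕ)) (F : Type w) [L.Structure F]
    (B : Set F) : Prop where
  mem_variety : InVariety E F
  closure_eq_top : Substructure.closure L B = ⊤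
  exists_extension : ∀ (M : Type w) [L.Structure M], InVariety E M →
    ∀ f : B → M, ∃ φ : F →[L] M, ∀ b : B, φ b = f b

variable (L) in
/-- `F` is a relatively free algebra with basis `B`: a free algebra of some variety of
`L`-algebras, freely generated by `B`. -/
def IsRelativelyFreeOn (F : Type w) [L.Structure F] (B : Set F) : Prop :=
  ∃ E : Set (L.Term ℕ × L.Term ℕ), IsFreeIn E F B

/-! ### Moieties and moietous automorphisms -/

/-- `J` is a moiety of the (infinite) set `I`: `J ⊆ I` and `|J| = |I ∖ J|`. -/
def IsMoiety {α : Type w} (J I : Set α) : Prop :=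
  J ⊆ I ∧ #J = #(I \ J : Set α)

/-- `σ` is moietous with regard to `B`: for some partition `B = B₁ ⊔ B₂` into moieties, `σ` fixes
`B₁` pointwise and the subalgebra generated by `B₂` setwise. -/
def IsMoietous {F : Type w} [L.Structure F] (B : Set F) (σ : F ≃[L] F) : Prop :=
  ∃ B₁ B₂ : Set F, B₁ ∪ B₂ = B ∧ Disjoint B₁ B₂ ∧ IsMoiety B₁ B ∧ IsMoiety B₂ B ∧
    σ ∈ stab B₁ (Substructure.closure L B₂ : Set F)

end RelFree

/-! Call an automorphism supported on a set `A` of basis elements, over parameters `D`, if it fixes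
the other basis elements and preserves the subalgebra generated by `A ∪ D`. Over a common `D`,
automorphisms with disjoint supports that miss `D` commute, and arbitrarily many of them can be
glued. As `S` has at most κ cosets, gluing along κ disjoint supports and diagonalizing yields a
support on which `S` induces every supported automorphism, up to a factor supported elsewhere
(`IsBasis.exists_projection`). Doing this twice, one block inside the other, puts all commutators
from the inner block into `S`. A shift along ℤ copies of a smaller block writes each automorphism
supported there as such a commutator, so `S` contains everything supported on some set of size κ
(`IsBasis.exists_supportedAut_le`).

The result is then transported by basis permutations lying in `S`. A second diagonal argument
(`exists_mem_moving_compl`) finds one that carries all but fewer than κ indices outside `A` into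
`A`; the exceptions form `D`. Hence `S` contains the permutations supported in `A` and in a second
set `A'`, where `A ∪ A'` is the complement of `D` and `A ∩ A'` is large. Together they conjugate any
support with large complement off `D` into a set where `S` already contains everything over `D`. -/

namespace RelFree

open FirstOrder.Language

/-! ### Supported automorphisms: commuting, gluing, projecting -/

section Basis

variable {L : FirstOrder.Language.{u, v}} {F : Type w} [L.Structure F] {ι : Type w}

theorem aut_mul_apply (σ τ : F ≃[L] F) (x : F) : (σ * τ) x = σ (τ x) := rfl

theorem aut_inv_apply_self (σ : F ≃[L] F) (x : F) : σ⁻¹ (σ x) = x := σ.symm_apply_apply x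

theorem aut_apply_inv_self (σ : F ≃[L] F) (x : F) : σ (σ⁻¹ x) = x := σ.apply_symm_apply x

theorem aut_eq_inv_apply (σ : F ≃[L] F) {x y : F} (h : σ x = y) : σ⁻¹ y = x := by
  rw [← h, aut_inv_apply_self]

/-- The family `b` generates `F`, and every map from it to `F` extends to an endomorphism. -/
structure IsBasis (L : FirstOrder.Language.{u, v}) {F : Type w} [L.Structure F] {ι : Type w}
    (b : ι → F) : Prop where
  closure_eq_top : Substructure.closure L (Set.range b) = ⊤
  exists_hom : ∀ f : ι → F, ∃ φ : F →[L] F, ∀ i, φ (b i) = f i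

theorem IsFreeIn.isBasis {E : Set (L.Term ℕ × L.Term ℕ)} {B : Set F} (h : IsFreeIn E F B) :
    IsBasis L ((↑) : B → F) :=
  ⟨by simpa using h.closure_eq_top, h.exists_extension F h.mem_variety⟩

theorem IsBasis.hom_ext {b : ι → F} (hb : IsBasis L b) {φ ψ : F →[L] F}
    (h : ∀ i, φ (b i) = ψ (b i)) : φ = ψ :=
  Hom.eq_of_eqOn_dense hb.closure_eq_top (by rintro _ ⟨i, rfl⟩; exact h i)

theorem IsBasis.aut_ext {b : ι → F} (hb : IsBasis L b) {σ τ : F ≃[L] F}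
    (h : ∀ i, σ (b i) = τ (b i)) : σ = τ := by
  have := hb.hom_ext (φ := σ.toHom) (ψ := τ.toHom) h
  exact FirstOrder.Language.Equiv.ext fun x => DFunLike.congr_fun this x

/-- Mutually inverse maps on a basis give an automorphism. -/
theorem IsBasis.exists_aut {b : ι → F} (hb : IsBasis L b) (φ ψ : F →[L] F)
    (h₁ : ∀ i, ψ (φ (b i)) = b i) (h₂ : ∀ i, φ (ψ (b i)) = b i) :
    ∃ σ : F ≃[L] F, (∀ x, σ x = φ x) ∧ ∀ x, σ⁻¹ x = ψ x := by
  have e₁ : ∀ x, ψ (φ x) = x := DFunLike.congr_fun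
    (hb.hom_ext (φ := ψ.comp φ) (ψ := Hom.id L F) h₁)
  have e₂ : ∀ x, φ (ψ x) = x := DFunLike.congr_fun
    (hb.hom_ext (φ := φ.comp ψ) (ψ := Hom.id L F) h₂)
  refine ⟨⟨⟨φ, ψ, e₁, e₂⟩, fun f x => φ.map_fun f x, fun {n} r x => ⟨fun h => ?_, φ.map_rel r x⟩⟩,
    fun _ => rfl, fun _ => rfl⟩
  have := ψ.map_rel r _ h
  have e : (⇑ψ ∘ (⇑φ ∘ x)) = x := funext fun k => e₁ _
  exact e ▸ this

theorem IsBasis.exists_permHom {b : ι → F} (hb : IsBasis L b) :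
    ∃ P : Equiv.Perm ι →* (F ≃[L] F), ∀ π i, P π (b i) = b (π i) := by
  have (π : Equiv.Perm ι) : ∃ σ : F ≃[L] F, ∀ i, σ (b i) = b (π i) := by
    obtain ⟨φ, hφ⟩ := hb.exists_hom fun i => b (π i)
    obtain ⟨ψ, hψ⟩ := hb.exists_hom fun i => b (π.symm i)
    obtain ⟨σ, hσ, -⟩ := hb.exists_aut φ ψ (fun i => by simp [hφ, hψ]) (fun i => by simp [hφ, hψ])
    exact ⟨σ, fun i => by rw [hσ, hφ]⟩
  choose P hP using this
  refine ⟨MonoidHom.mk' P fun π ρ => hb.aut_ext fun i => ?_, hP⟩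
  simp [aut_mul_apply, hP]

/-- The subalgebra generated by the basis elements with indices in `A`. -/
def span (L : FirstOrder.Language.{u, v}) {F : Type w} [L.Structure F] {ι : Type w} (b : ι → F)
    (A : Set ι) : L.Substructure F :=
  Substructure.closure L (b '' A)

theorem mem_span {b : ι → F} {A : Set ι} {i : ι} (hi : i ∈ A) : b i ∈ span L b A :=
  Substructure.subset_closure ⟨i, hi, rfl⟩

theorem span_mono {b : ι → F} {A A' : Set ι} (h : A ⊆ A') : span L b A ≤ span L b A' :=
  Substructure.closure_mono (Set.image_mono h)

theorem hom_eqOn_span {b : ι → F} {A : Set ι} {φ ψ : F →[L] F}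
    (h : ∀ i ∈ A, φ (b i) = ψ (b i)) {x : F} (hx : x ∈ span L b A) : φ x = ψ x :=
  Hom.eqOn_closure (s := b '' A) (by rintro _ ⟨i, hi, rfl⟩; exact h i hi) hx

theorem aut_eqOn_span {b : ι → F} {A : Set ι} {σ τ : F ≃[L] F}
    (h : ∀ i ∈ A, σ (b i) = τ (b i)) {x : F} (hx : x ∈ span L b A) : σ x = τ x :=
  hom_eqOn_span (φ := σ.toHom) (ψ := τ.toHom) h hx

theorem aut_mem_span {b : ι → F} {A : Set ι} {K : L.Substructure F} {σ : F ≃[L] F}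
    (h : ∀ i ∈ A, σ (b i) ∈ K) {x : F} (hx : x ∈ span L b A) : σ x ∈ K := by
  have : span L b A ≤ K.comap σ.toHom :=
    Substructure.closure_le.2 (by rintro _ ⟨i, hi, rfl⟩; exact h i hi)
  exact this hx

/-- The automorphisms that fix the basis elements with indices outside `A` and preserve the
subalgebra generated by those with indices in `A ∪ D`. -/
def supportedAut (L : FirstOrder.Language.{u, v}) {F : Type w} [L.Structure F] {ι : Type w}
    (b : ι → F) (D A : Set ι) : Subgroup (F ≃[L] F) :=
  stab (b '' Aᶜ) (span L b (A ∪ D) : Set F)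

theorem mem_supportedAut_of {b : ι → F} {D A : Set ι} {σ : F ≃[L] F}
    (h₁ : ∀ i ∉ A, σ (b i) = b i) (h₂ : ∀ i ∈ A, σ (b i) ∈ span L b (A ∪ D))
    (h₃ : ∀ i ∈ A, σ⁻¹ (b i) ∈ span L b (A ∪ D)) : σ ∈ supportedAut L b D A := by
  refine Subgroup.mem_inf.2 ⟨?_, ?_⟩
  · rw [mem_fixingSubgroup_iff]
    rintro _ ⟨i, hi, rfl⟩
    exact h₁ i hi
  · have key (τ : F ≃[L] F) (h₁ : ∀ i ∉ A, τ (b i) = b i)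
        (h₂ : ∀ i ∈ A, τ (b i) ∈ span L b (A ∪ D)) {x : F} (hx : x ∈ span L b (A ∪ D)) :
        τ x ∈ span L b (A ∪ D) := by
      refine aut_mem_span (fun i hi => ?_) hx
      by_cases hA : i ∈ A
      · exact h₂ i hA
      · rw [h₁ i hA]; exact mem_span hi
    rw [MulAction.mem_stabilizer_iff]
    ext x
    rw [Set.mem_smul_set_iff_inv_smul_mem]
    constructor
    · intro h
      have := key σ h₁ h₂ h
      rwa [aut_smul_def, aut_apply_inv_self] at this
    · exact key σ⁻¹ (fun i hi => aut_eq_inv_apply σ (h₁ i hi)) h₃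

theorem supportedAut_apply_eq {b : ι → F} {D A : Set ι} {σ : F ≃[L] F}
    (h : σ ∈ supportedAut L b D A) {i : ι} (hi : i ∉ A) : σ (b i) = b i :=
  (mem_fixingSubgroup_iff (M := F ≃[L] F)).1 h.1 _ ⟨i, hi, rfl⟩

theorem supportedAut_fix_span {b : ι → F} {D A A' : Set ι} {σ : F ≃[L] F}
    (h : σ ∈ supportedAut L b D A) (hA : Disjoint A A') {x : F} (hx : x ∈ span L b A') :
    σ x = x :=
  aut_eqOn_span (τ := 1) (fun _ hi => supportedAut_apply_eq h (hA.notMem_of_mem_right hi)) hx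

theorem supportedAut_apply_mem {b : ι → F} {D A : Set ι} {σ : F ≃[L] F}
    (h : σ ∈ supportedAut L b D A) {x : F} (hx : x ∈ span L b (A ∪ D)) :
    σ x ∈ span L b (A ∪ D) := by
  have hs : σ • (span L b (A ∪ D) : Set F) = span L b (A ∪ D) := MulAction.mem_stabilizer_iff.1 h.2
  exact hs.subset (Set.smul_mem_smul_set (a := σ) hx)

theorem supportedAut_mono {b : ι → F} {D A A' : Set ι} (hA : A ⊆ A') :
    supportedAut L b D A ≤ supportedAut L b D A' := by
  have key (σ : F ≃[L] F) (h : σ ∈ supportedAut L b D A) (i : ι) (hi : i ∈ A') :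
      σ (b i) ∈ span L b (A' ∪ D) := by
    by_cases hiA : i ∈ A
    · exact span_mono (Set.union_subset_union_left D hA)
        (supportedAut_apply_mem h (mem_span (Or.inl hiA)))
    · rw [supportedAut_apply_eq h hiA]; exact mem_span (Or.inl hi)
  exact fun σ h => mem_supportedAut_of
    (fun i hi => supportedAut_apply_eq h fun h' => hi (hA h')) (key σ h) (key σ⁻¹ (inv_mem h))

/-- For `i ∈ A` the value `σ (b i)` lies in the span of `A ∪ D`, which `τ` fixes pointwise because
`A'` misses both `A` and `D`; the other case is symmetric. -/
theorem IsBasis.supportedAut_commute {b : ι → F} (hb : IsBasis L b) {D A A' : Set ι}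
    (hAA : Disjoint A A') (hA : Disjoint A D) (hA' : Disjoint A' D) {σ τ : F ≃[L] F}
    (hσ : σ ∈ supportedAut L b D A) (hτ : τ ∈ supportedAut L b D A') : σ * τ = τ * σ := by
  refine hb.aut_ext fun i => ?_
  simp only [aut_mul_apply]
  by_cases hi : i ∈ A
  · rw [supportedAut_apply_eq hτ (hAA.notMem_of_mem_left hi), supportedAut_fix_span hτ
      (hAA.symm.union_right hA') (supportedAut_apply_mem hσ (mem_span (Or.inl hi)))]
  · rw [supportedAut_apply_eq hσ hi]
    by_cases hi' : i ∈ A'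
    · rw [supportedAut_fix_span hσ
        (hAA.union_right hA) (supportedAut_apply_mem hτ (mem_span (Or.inl hi')))]
    · rw [supportedAut_apply_eq hτ hi', supportedAut_apply_eq hσ hi]

theorem permHom_mem_supportedAut {b : ι → F} {P : Equiv.Perm ι →* (F ≃[L] F)}
    (hP : ∀ π i, P π (b i) = b (π i)) {D A : Set ι} {π : Equiv.Perm ι}
    (hπ : ∀ i ∉ A, π i = i) : P π ∈ supportedAut L b D A := by
  have hmem (i : ι) (hi : i ∈ A) : π i ∈ A := by
    by_contra h
    exact h (by rwa [π.injective (hπ _ h)])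
  have hmem' (i : ι) (hi : i ∈ A) : π⁻¹ i ∈ A := by
    by_contra h
    have h' : i = π⁻¹ i := (π.apply_symm_apply i).symm.trans (hπ _ h)
    exact h (h' ▸ hi)
  refine mem_supportedAut_of (fun i hi => by rw [hP, hπ i hi]) (fun i hi => ?_) fun i hi => ?_
  · rw [hP]; exact mem_span (Or.inl (hmem i hi))
  · rw [← map_inv, hP]; exact mem_span (Or.inl (hmem' i hi))

/-- Since `π` fixes `D`, it carries the span of `A ∪ D` to that of `π '' A ∪ D`: the parameters
survive conjugation. -/
theorem permHom_conj_mem {b : ι → F} {P : Equiv.Perm ι →* (F ≃[L] F)}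
    (hP : ∀ π i, P π (b i) = b (π i)) {D A : Set ι} {π : Equiv.Perm ι} (hπ : ∀ i ∈ D, π i = i)
    {σ : F ≃[L] F} (hσ : σ ∈ supportedAut L b D A) :
    P π * σ * (P π)⁻¹ ∈ supportedAut L b D (π '' A) := by
  have hinv (i : ι) : (P π)⁻¹ (b i) = b (π⁻¹ i) := by rw [← map_inv, hP]
  have key (τ : F ≃[L] F) (hτ : τ ∈ supportedAut L b D A) (i : ι) (hi : i ∈ π '' A) :
      (P π * τ * (P π)⁻¹) (b i) ∈ span L b (π '' A ∪ D) := by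
    obtain ⟨k, hk, rfl⟩ := hi
    rw [aut_mul_apply, aut_mul_apply, hinv, show π⁻¹ (π k) = k from π.symm_apply_apply k]
    refine aut_mem_span (fun j hj => ?_) (supportedAut_apply_mem hτ (mem_span (Or.inl hk)))
    rw [hP]
    exact mem_span (hj.imp (fun h => ⟨j, h, rfl⟩) fun h => by rwa [hπ j h])
  refine mem_supportedAut_of (fun i hi => ?_) (key σ hσ) fun i hi => ?_
  · have : π⁻¹ i ∉ A := fun h => hi ⟨_, h, π.apply_symm_apply i⟩
    rw [aut_mul_apply, aut_mul_apply, hinv, supportedAut_apply_eq hσ this, hP,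
      show π (π⁻¹ i) = i from π.apply_symm_apply i]
  · have := key σ⁻¹ (inv_mem hσ) i hi
    rwa [show (P π * σ * (P π)⁻¹)⁻¹ = P π * σ⁻¹ * (P π)⁻¹ by group]

/-- Automorphisms supported on disjoint sets have a common extension. -/
theorem IsBasis.exists_glue {b : ι → F} (hb : IsBasis L b) {D : Set ι} {J : Type*}
    {A : J → Set ι} (hA : Pairwise fun j k => Disjoint (A j) (A k)) (hD : ∀ j, Disjoint (A j) D)
    (a : J → (F ≃[L] F)) (ha : ∀ j, a j ∈ supportedAut L b D (A j)) :
    ∃ g : F ≃[L] F, (∀ j, ∀ i ∈ A j, g (b i) = a j (b i) ∧ g⁻¹ (b i) = (a j)⁻¹ (b i)) ∧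
      ∀ i, (∀ j, i ∉ A j) → g (b i) = b i ∧ g⁻¹ (b i) = b i := by
  classical
  have endo (c : J → (F ≃[L] F)) : ∃ φ : F →[L] F, (∀ j, ∀ i ∈ A j, φ (b i) = c j (b i)) ∧
      ∀ i, (∀ j, i ∉ A j) → φ (b i) = b i := by
    obtain ⟨φ, hφ⟩ := hb.exists_hom fun i => if h : ∃ j, i ∈ A j then c h.choose (b i) else b i
    refine ⟨φ, fun j i hi => ?_, fun i hi => ?_⟩
    · have h : ∃ j, i ∈ A j := ⟨j, hi⟩
      have : h.choose = j := by
        by_contra hne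
        exact (hA hne).notMem_of_mem_left h.choose_spec hi
      rw [hφ, dif_pos h, this]
    · rw [hφ, dif_neg (not_exists.2 hi)]
  have inv (c d : J → (F ≃[L] F)) (hc : ∀ j, c j ∈ supportedAut L b D (A j))
      (hd : ∀ j, d j ∈ supportedAut L b D (A j)) (hcd : ∀ j x, d j (c j x) = x) (φ ψ : F →[L] F)
      (hφ : (∀ j, ∀ i ∈ A j, φ (b i) = c j (b i)) ∧ ∀ i, (∀ j, i ∉ A j) → φ (b i) = b i)
      (hψ : (∀ j, ∀ i ∈ A j, ψ (b i) = d j (b i)) ∧ ∀ i, (∀ j, i ∉ A j) → ψ (b i) = b i)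
      (i : ι) : ψ (φ (b i)) = b i := by
    by_cases h : ∃ j, i ∈ A j
    · obtain ⟨j, hj⟩ := h
      rw [hφ.1 j i hj]
      -- The value `c j (b i)` lies in the span of `A j ∪ D`, where `ψ` agrees with `d j`: by
      -- construction on `A j`, and because both fix `D`.
      refine (hom_eqOn_span (ψ := (d j).toHom) (fun k hk => ?_)
        (supportedAut_apply_mem (hc j) (mem_span (Or.inl hj)))).trans (hcd j (b i))
      rcases hk with hk | hk
      · exact hψ.1 j k hk
      · rw [hψ.2 k fun l => (hD l).notMem_of_mem_right hk]
        exact (supportedAut_apply_eq (hd j) ((hD j).notMem_of_mem_right hk)).symm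
    · rw [not_exists] at h
      rw [hφ.2 i h, hψ.2 i h]
  obtain ⟨φ, hφ⟩ := endo a
  obtain ⟨ψ, hψ⟩ := endo fun j => (a j)⁻¹
  have ha' : ∀ j, (a j)⁻¹ ∈ supportedAut L b D (A j) := fun j => inv_mem (ha j)
  obtain ⟨g, hg, hg'⟩ := hb.exists_aut φ ψ
    (inv _ _ ha ha' (fun j => aut_inv_apply_self (a j)) φ ψ hφ hψ)
    (inv _ _ ha' ha (fun j => aut_apply_inv_self (a j)) ψ φ hψ hφ)
  refine ⟨g, fun j i hi => ?_, fun i hi => ?_⟩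
  · rw [hg, hg', hφ.1 j i hi, hψ.1 j i hi]; exact ⟨rfl, rfl⟩
  · rw [hg, hg', hφ.2 i hi, hψ.2 i hi]; exact ⟨rfl, rfl⟩

/-- Each `a k` with `k ≠ j` keeps its values in the span of `(Y \ A j) ∪ D`, where `a j` acts
trivially; so `a j` splits off from the glued automorphism. -/
theorem IsBasis.exists_glue_mem {b : ι → F} (hb : IsBasis L b) {D Y : Set ι} {J : Type*}
    {A : J → Set ι} (hA : Pairwise fun j k => Disjoint (A j) (A k)) (hY : ∀ j, A j ⊆ Y)
    (hD : Disjoint Y D) (a : J → (F ≃[L] F)) (ha : ∀ j, a j ∈ supportedAut L b D (A j)) :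
    ∃ g : F ≃[L] F, ∀ j, (a j)⁻¹ * g ∈ supportedAut L b D (Y \ A j) := by
  have hAD (j : J) : Disjoint (A j) D := hD.mono_left (hY j)
  obtain ⟨g, hg, hg'⟩ := hb.exists_glue hA hAD a ha
  refine ⟨g, fun j => ?_⟩
  have hfix (c : F ≃[L] F) (hc : c ∈ supportedAut L b D (A j)) {x : F}
      (hx : x ∈ span L b (Y \ A j ∪ D)) : c x = x :=
    supportedAut_fix_span hc (Set.disjoint_sdiff_right.union_right (hAD j)) hx
  have hmem (k : J) (c : F ≃[L] F) (hc : c ∈ supportedAut L b D (A k)) (hkj : k ≠ j) (i : ι)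
      (hi : i ∈ A k) : c (b i) ∈ span L b (Y \ A j ∪ D) := by
    refine span_mono (Set.union_subset_union_left D fun l hl => ?_)
      (supportedAut_apply_mem hc (mem_span (Or.inl hi)))
    exact ⟨hY k hl, (hA hkj).notMem_of_mem_left hl⟩
  have hgmem (i : ι) (hi : i ∈ Y \ A j) :
      g (b i) ∈ span L b (Y \ A j ∪ D) ∧ g⁻¹ (b i) ∈ span L b (Y \ A j ∪ D) := by
    by_cases h : ∃ k, i ∈ A k
    · obtain ⟨k, hk⟩ := h
      have hkj : k ≠ j := by rintro rfl; exact hi.2 hk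
      rw [(hg k i hk).1, (hg k i hk).2]
      exact ⟨hmem k _ (ha k) hkj i hk, hmem k _ (inv_mem (ha k)) hkj i hk⟩
    · rw [not_exists] at h
      rw [(hg' i h).1, (hg' i h).2]
      exact ⟨mem_span (Or.inl hi), mem_span (Or.inl hi)⟩
  refine mem_supportedAut_of (fun i hi => ?_) (fun i hi => ?_) fun i hi => ?_
  · rw [aut_mul_apply]
    by_cases hij : i ∈ A j
    · rw [(hg j i hij).1, aut_inv_apply_self]
    · have hiY : i ∉ Y := fun h => hi ⟨h, hij⟩
      rw [(hg' i fun k hk => hiY (hY k hk)).1, supportedAut_apply_eq (inv_mem (ha j)) hij]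
  · rw [aut_mul_apply, hfix _ (inv_mem (ha j)) (hgmem i hi).1]
    exact (hgmem i hi).1
  · rw [mul_inv_rev, inv_inv, aut_mul_apply, supportedAut_apply_eq (ha j) hi.2]
    exact (hgmem i hi).2

/-- Given a subgroup of small index and many disjoint supports, for one of the supports the
subgroup projects onto all automorphisms supported there. -/
theorem IsBasis.exists_projection {b : ι → F} (hb : IsBasis L b) (S : Subgroup (F ≃[L] F))
    {D Y : Set ι} {J : Type*} (q : J → (F ≃[L] F) ⧸ S) (hq : q.Surjective) {A : J → Set ι}
    (hA : Pairwise fun j k => Disjoint (A j) (A k)) (hY : ∀ j, A j ⊆ Y) (hD : Disjoint Y D) :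
    ∃ j, ∀ a ∈ supportedAut L b D (A j), ∃ s ∈ supportedAut L b D (Y \ A j), a * s ∈ S := by
  -- Otherwise pick for each `j` an `a j` with no product `a j * s` in the coset `q j`; the glued
  -- automorphism would then avoid every coset.
  have : ∃ j, ∀ a ∈ supportedAut L b D (A j), ∃ s ∈ supportedAut L b D (Y \ A j),
      ((a * s : F ≃[L] F) : (F ≃[L] F) ⧸ S) = q j := by
    by_contra! h
    choose a ha h using h
    obtain ⟨g, hg⟩ := hb.exists_glue_mem hA hY hD a ha
    obtain ⟨j, hj⟩ := hq (g : (F ≃[L] F) ⧸ S)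
    exact h j _ (hg j) (by rw [hj, mul_inv_cancel_left])
  obtain ⟨j, hj⟩ := this
  refine ⟨j, fun a ha => ?_⟩
  obtain ⟨s, hs, hs'⟩ := hj a ha
  -- Comparison with `a = 1` replaces the coset `q j` by `S` itself, since `t` commutes with `a`.
  obtain ⟨t, ht, ht'⟩ := hj 1 (one_mem _)
  refine ⟨t⁻¹ * s, mul_mem (inv_mem ht) hs, ?_⟩
  have hc := hb.supportedAut_commute Set.disjoint_sdiff_right (hD.mono_left (hY j))
    (hD.mono_left Set.sdiff_subset) ha (inv_mem ht)
  rw [one_mul] at ht'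
  rw [← mul_assoc, hc, mul_assoc]
  exact QuotientGroup.eq.1 (ht'.trans hs'.symm)

end Basis

/-! ### Commutators, and a large support inside the subgroup -/

section Supports

variable {L : FirstOrder.Language.{u, v}} {F : Type w} [L.Structure F] {ι : Type w}

/-- An automorphism with support in one part of a `ℤ`-indexed family of parts is a commutator of
automorphisms supported in the union of the family. -/
theorem IsBasis.exists_commutator {b : ι → F} (hb : IsBasis L b) {D : Set ι} (d : ℤ × ι ↪ ι)
    (hD : Disjoint (Set.range d) D) {σ : F ≃[L] F}
    (hσ : σ ∈ supportedAut L b D (Set.range fun k => d (0, k))) :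
    ∃ a ∈ supportedAut L b D (Set.range d), ∃ t ∈ supportedAut L b D (Set.range d),
      σ = a * t * a⁻¹ * t⁻¹ := by
  obtain ⟨P, hP⟩ := hb.exists_permHom
  let T (n : ℤ) : Set ι := Set.range fun k => d (n, k)
  have hT (n : ℤ) : T n ⊆ Set.range d := by rintro _ ⟨k, rfl⟩; exact ⟨_, rfl⟩
  have hTdisj {m n : ℤ} (h : m ≠ n) : Disjoint (T m) (T n) := by
    rw [Set.disjoint_left]
    rintro _ ⟨k, rfl⟩ ⟨l, hl⟩
    exact h (congrArg Prod.fst (d.injective hl)).symm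
  let τ : Equiv.Perm ι :=
    Equiv.Perm.viaEmbedding ((Equiv.addRight (1 : ℤ)).prodCongr (Equiv.refl ι)) d
  have hτ (m : ℤ) (k : ι) : τ (d (m, k)) = d (m + 1, k) := Equiv.Perm.viaEmbedding_apply _ d (m, k)
  have hτ' : ∀ i ∉ Set.range d, τ i = i := Equiv.Perm.viaEmbedding_apply_of_notMem _ d
  have hτpow (n : ℕ) (m : ℤ) (k : ι) : (τ ^ n) (d (m, k)) = d (m + n, k) := by
    induction n with
    | zero => simp
    | succ n ih => rw [pow_succ', Equiv.Perm.mul_apply, ih, hτ]; push_cast; rw [add_assoc]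
  have hτD (n : ℕ) : ∀ i ∈ D, (τ ^ n) i = i := fun i hi => by
    induction n with
    | zero => rfl
    | succ n ih => rw [pow_succ', Equiv.Perm.mul_apply, ih, hτ' i (hD.notMem_of_mem_right hi)]
  -- `c n` is the copy of `σ` on the `n`-th block. Their glued product `a` over `n ≥ 0` loses
  -- exactly the factor `σ` when conjugated by the shift.
  let c (n : ℕ) : F ≃[L] F := P (τ ^ n) * σ * (P (τ ^ n))⁻¹
  have hc (n : ℕ) : c n ∈ supportedAut L b D (T n) := by
    have := permHom_conj_mem hP (hτD n) hσ
    have e : (⇑(τ ^ n) ∘ fun k => d (0, k)) = fun k => d ((n : ℤ), k) :=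
      funext fun k => by rw [Function.comp_apply, hτpow, zero_add]
    rwa [← Set.range_comp, e] at this
  have hcsucc (n : ℕ) : c (n + 1) = P τ * c n * (P τ)⁻¹ := by
    simp only [c, pow_succ', map_mul]; group
  have hY (n : ℕ) : T n ⊆ ⋃ n : ℕ, T n := Set.subset_iUnion (fun n : ℕ => T n) n
  have hYd : ⋃ n : ℕ, T n ⊆ Set.range d := Set.iUnion_subset fun n => hT n
  obtain ⟨a, ha⟩ := hb.exists_glue_mem (Y := ⋃ n : ℕ, T n) (A := fun n : ℕ => T n)
    (fun m n h => hTdisj (by exact_mod_cast h)) hY (hD.mono_left hYd) c hc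
  have haY : a ∈ supportedAut L b D (⋃ n : ℕ, T n) := by
    have := mul_mem (supportedAut_mono (hY 0) (hc 0)) (supportedAut_mono Set.sdiff_subset (ha 0))
    rwa [mul_inv_cancel_left] at this
  have haT (n : ℕ) (k : ι) : a (b (d (n, k))) = c n (b (d (n, k))) := by
    have h := supportedAut_apply_eq (ha n) (i := d (n, k)) fun h => h.2 ⟨k, rfl⟩
    rw [aut_mul_apply] at h
    exact (aut_apply_inv_self (c n) _).symm.trans (congrArg (c n) h)
  have haneg (m : ℤ) (hm : m < 0) (k : ι) : a (b (d (m, k))) = b (d (m, k)) := by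
    refine supportedAut_apply_eq haY fun h => ?_
    obtain ⟨n, hn⟩ := Set.mem_iUnion.1 h
    exact (hTdisj (m := m) (n := n) (by omega)).notMem_of_mem_left ⟨k, rfl⟩ hn
  have hinv (m : ℤ) (k : ι) : (P τ)⁻¹ (b (d (m, k))) = b (d (m - 1, k)) :=
    aut_eq_inv_apply _ (by rw [hP, hτ, sub_add_cancel])
  have hσT (m : ℤ) (hm : m ≠ 0) (k : ι) : σ (b (d (m, k))) = b (d (m, k)) :=
    supportedAut_apply_eq hσ ((hTdisj hm).notMem_of_mem_left ⟨k, rfl⟩)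
  refine ⟨a, supportedAut_mono hYd haY, P τ, permHom_mem_supportedAut hP hτ', ?_⟩
  have key : σ * (P τ * a * (P τ)⁻¹) = a := by
    refine hb.aut_ext fun i => ?_
    simp only [aut_mul_apply]
    by_cases hi : i ∈ Set.range d
    · obtain ⟨⟨m, k⟩, rfl⟩ := hi
      rw [hinv]
      rcases lt_trichotomy m 0 with hm | rfl | hm
      · rw [haneg _ (by omega), hP, hτ, sub_add_cancel, hσT m hm.ne, haneg m hm]
      · rw [haneg _ (by omega), hP, hτ, sub_add_cancel]
        have := haT 0 k
        simp only [c, pow_zero, map_one, one_mul, inv_one, mul_one, Nat.cast_zero] at this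
        exact this.symm
      · obtain ⟨n, rfl⟩ : ∃ n : ℕ, m = (n + 1 : ℕ) := ⟨(m - 1).toNat, by omega⟩
        have e : (((n + 1 : ℕ) : ℤ) - 1) = n := by omega
        have h : P τ (c n (b (d ((n : ℤ), k)))) = c (n + 1) (b (d (((n + 1 : ℕ) : ℤ), k))) := by
          rw [hcsucc, aut_mul_apply (P τ * c n), aut_mul_apply (P τ), hinv, e]
        rw [e, haT, h, haT]
        exact supportedAut_fix_span hσ
          ((hTdisj (m := 0) (by omega)).union_right (hD.mono_left (hT 0)))
          (supportedAut_apply_mem (hc (n + 1)) (mem_span (Or.inl ⟨k, rfl⟩)))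
    · have h1 : (P τ)⁻¹ (b i) = b i := aut_eq_inv_apply _ (by rw [hP, hτ' i hi])
      have h2 : a (b i) = b i := supportedAut_apply_eq haY fun h => hi (hYd h)
      rw [h1, h2, hP, hτ' i hi]
      exact supportedAut_apply_eq hσ fun h => hi (hT 0 h)
  calc σ = σ * (P τ * a * (P τ)⁻¹) * (P τ * a⁻¹ * (P τ)⁻¹) := by group
    _ = a * P τ * a⁻¹ * (P τ)⁻¹ := by rw [key]; group

/-- Any set of full size contains a large set such that the automorphisms supported there lie in a
given subgroup of small index. -/
theorem IsBasis.exists_supportedAut_le {b : ι → F} (hb : IsBasis L b) (hι : ℵ₀ ≤ #ι)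
    (S : Subgroup (F ≃[L] F)) (hS : #((F ≃[L] F) ⧸ S) ≤ #ι) {D Y : Set ι} (hD : Disjoint Y D)
    (hY : #ι ≤ #Y) :
    ∃ C ⊆ Y, #ι ≤ #C ∧ #ι ≤ #(Y \ C : Set ι) ∧ supportedAut L b D C ≤ S := by
  obtain ⟨f⟩ := hS
  -- This enumerates the cosets of `S` by `ι`, possibly with repetitions.
  have hq := Function.invFun_surjective f.injective
  obtain ⟨y⟩ := hY
  obtain ⟨p⟩ : Nonempty (ι × ι ≃ ι) := Cardinal.eq.1 (by rw [mk_prod, lift_id, mul_eq_self hι])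
  obtain ⟨z⟩ : Nonempty (ℤ × ι ≃ ι) := Cardinal.eq.1 (by
    rw [mk_prod, mk_int, lift_aleph0, lift_uzero, aleph0_mul_eq hι])
  have disj (g : ι ↪ ι) : Pairwise fun j k =>
      Disjoint (Set.range fun l => g (p (j, l))) (Set.range fun l => g (p (k, l))) := by
    intro j k hjk
    rw [Set.disjoint_left]
    rintro _ ⟨l, rfl⟩ ⟨m, hm⟩
    exact hjk (congrArg Prod.fst (p.injective (g.injective hm))).symm
  let y₀ : ι ↪ ι := y.trans (Function.Embedding.subtype _)
  obtain ⟨j, hj⟩ := hb.exists_projection S _ hq (disj y₀) (Y := Y)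
    (by rintro j _ ⟨l, rfl⟩; exact (y _).2) hD
  let y₁ : ι ↪ ι := ⟨fun l => y₀ (p (j, l)), fun l m h => by simpa using h⟩
  have hy₁ : Set.range y₁ ⊆ Y := by rintro _ ⟨l, rfl⟩; exact (y _).2
  -- The second choice stays inside the first block, so the correction `r` below is supported in
  -- that block and the correction `s` outside it.
  obtain ⟨k, hk⟩ := hb.exists_projection S _ hq (disj y₁) (Y := Set.range y₁)
    (by rintro j _ ⟨l, rfl⟩; exact ⟨_, rfl⟩) (hD.mono_left hy₁)
  let y₂ : ι ↪ ι := ⟨fun l => y₁ (p (k, l)), fun l m h => by simpa using h⟩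
  have hy₂ : Set.range y₂ ⊆ Set.range y₁ := by rintro _ ⟨l, rfl⟩; exact ⟨_, rfl⟩
  let d : ℤ × ι ↪ ι := z.toEmbedding.trans y₂
  have hd : Set.range d ⊆ Set.range y₂ := by rintro _ ⟨l, rfl⟩; exact ⟨_, rfl⟩
  have card (n : ℤ) : #ι ≤ #(Set.range fun l => d (n, l)) := by
    rw [mk_range_eq _ fun l m h => by simpa using h]
  refine ⟨Set.range fun l => d (0, l), ?_, card 0, (card 1).trans (mk_le_mk_of_subset ?_), ?_⟩
  · rintro _ ⟨l, rfl⟩; exact hy₁ (hy₂ (hd ⟨_, rfl⟩))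
  · rintro _ ⟨l, rfl⟩
    refine ⟨hy₁ (hy₂ (hd ⟨_, rfl⟩)), ?_⟩
    rintro ⟨m, hm⟩
    simpa using d.injective hm
  · intro σ hσ
    obtain ⟨a, ha, t, ht, rfl⟩ :=
      hb.exists_commutator d (hD.mono_left (hd.trans (hy₂.trans hy₁))) hσ
    have ha₂ := supportedAut_mono hd ha
    have ht₂ := supportedAut_mono hd ht
    obtain ⟨s, hs, has⟩ := hj a (supportedAut_mono hy₂ ha₂)
    obtain ⟨r, hr, htr⟩ := hk t ht₂
    have comm {A A' : Set ι} (hA : A ⊆ Y) (hA' : A' ⊆ Y) (hAA : Disjoint A A') {σ τ : F ≃[L] F}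
        (hσ : σ ∈ supportedAut L b D A) (hτ : τ ∈ supportedAut L b D A') : Commute σ τ :=
      hb.supportedAut_commute hAA (hD.mono_left hA) (hD.mono_left hA') hσ hτ
    have hst : Commute s (t * r) := comm Set.sdiff_subset hy₁ Set.disjoint_sdiff_left hs
      (mul_mem (supportedAut_mono hy₂ ht₂) (supportedAut_mono Set.sdiff_subset hr))
    have hra : Commute r a := comm (Set.sdiff_subset.trans hy₁) (hy₂.trans hy₁)
      Set.disjoint_sdiff_left hr ha₂
    -- As `s` commutes with `t * r` and `r` with `a`, both corrections cancel from the commutator.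
    have : a * t * a⁻¹ * t⁻¹ = a * s * (t * r) * (a * s)⁻¹ * (t * r)⁻¹ := by
      calc a * t * a⁻¹ * t⁻¹ = a * t * a⁻¹ * r * r⁻¹ * t⁻¹ := by group
        _ = a * t * (a⁻¹ * r) * r⁻¹ * t⁻¹ := by group
        _ = a * t * (r * a⁻¹) * r⁻¹ * t⁻¹ := by rw [(hra.inv_right).eq]
        _ = a * (t * r) * s * s⁻¹ * a⁻¹ * (t * r)⁻¹ := by group
        _ = a * ((t * r) * s) * s⁻¹ * a⁻¹ * (t * r)⁻¹ := by group
        _ = a * s * (t * r) * (a * s)⁻¹ * (t * r)⁻¹ := by rw [← hst.eq]; group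
    rw [this]
    exact mul_mem (mul_mem (mul_mem has htr) (inv_mem has)) (inv_mem htr)

end Supports

/-! ### Permutations of the index set -/

section Permutations

variable {ι : Type w}

/-- A partial injection between subsets of `A` with large complements in `A` is the restriction of
a permutation supported in `A`. -/
theorem exists_perm_image_subset {A P Q : Set ι} (hP : P ⊆ A) (hQ : Q ⊆ A)
    (hAP : #ι ≤ #(A \ P : Set ι)) (hAQ : #ι ≤ #(A \ Q : Set ι)) (hcard : #ι ≤ #Q) :
    ∃ π : Equiv.Perm ι, (∀ i ∉ A, π i = i) ∧ π '' P ⊆ Q := by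
  classical
  obtain ⟨k⟩ : Nonempty (P ↪ Q) := (mk_set_le P).trans hcard
  have hmem (x : ↥(P ∪ Aᶜ)) (h : x.1 ∉ P) : x.1 ∉ A := x.2.resolve_left h
  -- `f` embeds `P` into `Q` and is the identity off `A`. Its domain and range have complements of
  -- full size, so it extends to a permutation.
  let f (x : ↥(P ∪ Aᶜ)) : ι := if h : x.1 ∈ P then k ⟨x, h⟩ else x
  have hf : Function.Injective f := by
    intro x y h
    by_cases hx : x.1 ∈ P <;> by_cases hy : y.1 ∈ P <;> simp only [f, hx, hy, dite_true,
      dite_false] at h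
    · simpa [Subtype.ext_iff] using k.injective (Subtype.ext h)
    · exact absurd (h ▸ hQ (k _).2) (hmem y hy)
    · exact absurd (h ▸ hQ (k _).2) (hmem x hx)
    · exact Subtype.ext h
  have hc₁ : #ι ≤ #↥(P ∪ Aᶜ)ᶜ := hAP.trans (mk_le_mk_of_subset (by
    rintro i ⟨hi, hi'⟩ (h | h)
    exacts [hi' h, h hi]))
  have hc₂ : #ι ≤ #↥(Set.range f)ᶜ := hAQ.trans (mk_le_mk_of_subset (by
    rintro i ⟨hi, hi'⟩ ⟨x, rfl⟩
    by_cases hx : x.1 ∈ P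
    · simp only [f, hx, dite_true] at hi'
      exact hi' (k _).2
    · simp only [f, hx, dite_false] at hi
      exact hmem x hx hi))
  obtain ⟨π, hπ⟩ := extend_function ⟨f, hf⟩
    (Cardinal.eq.1 (((mk_set_le _).antisymm hc₁).trans ((mk_set_le _).antisymm hc₂).symm))
  refine ⟨π, fun i hi => ?_, ?_⟩
  · have := hπ ⟨i, Or.inr hi⟩
    rwa [Function.Embedding.coeFn_mk, show f ⟨i, Or.inr hi⟩ = i from
      dif_neg fun h => hi (hP h)] at this
  · rintro _ ⟨i, hi, rfl⟩
    have := hπ ⟨i, Or.inl hi⟩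
    rw [Function.Embedding.coeFn_mk, show f ⟨i, Or.inl hi⟩ = k ⟨i, hi⟩ from dif_pos hi] at this
    rw [this]
    exact (k _).2

theorem perm_apply_mem {A : Set ι} {π : Equiv.Perm ι} (hπ : ∀ i ∉ A, π i = i) {i : ι}
    (hi : i ∈ A) : π i ∈ A := by
  by_contra h
  exact h (by rwa [π.injective (hπ _ h)])

/-- If `H` contains the permutations supported in `A` and those supported in `A'`, some element of
`H` moves `C₁ ⊆ A ∪ A'` into `C₀ ⊆ A ∩ A'`, provided there is enough room. -/
theorem exists_perm_mem_image_subset {H : Subgroup (Equiv.Perm ι)} {A A' C₀ C₁ : Set ι}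
    (hA : ∀ π : Equiv.Perm ι, (∀ i ∉ A, π i = i) → π ∈ H)
    (hA' : ∀ π : Equiv.Perm ι, (∀ i ∉ A', π i = i) → π ∈ H)
    (hC₀ : C₀ ⊆ A ∩ A') (hcard : #ι ≤ #C₀) (hcard' : #ι ≤ #((A ∩ A') \ C₀ : Set ι))
    (hC₁ : C₁ ⊆ A ∪ A') (hAC₁ : #ι ≤ #(A \ C₁ : Set ι)) :
    ∃ π ∈ H, (∀ i ∉ A ∪ A', π i = i) ∧ π '' C₁ ⊆ C₀ := by
  -- `U` is reserved room. First `p` moves `C₁` off `U`, then `q` moves what lies in `A'` into `C₀`,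
  -- so that everything lies in `A`; finally `r` moves it all into `C₀`. Avoiding `U` supplies the
  -- large complements for `q` and `r`.
  set U : Set ι := (A ∩ A') \ C₀ with hU
  have hAC₀ : #ι ≤ #(A \ C₀ : Set ι) :=
    hcard'.trans (mk_le_mk_of_subset (Set.sdiff_subset_sdiff_left Set.inter_subset_left))
  obtain ⟨p, hp, hpC⟩ := exists_perm_image_subset (A := A) (P := A ∩ C₁) (Q := A \ U)
    Set.inter_subset_left Set.sdiff_subset (by rwa [Set.sdiff_self_inter])
    (hcard'.trans (mk_le_mk_of_subset fun i hi => ⟨hi.1.1, fun h => h.2 hi⟩))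
    (hcard.trans (mk_le_mk_of_subset fun i hi => ⟨(hC₀ hi).1, fun h => h.2 hi⟩))
  have hpU (i : ι) (hi : i ∈ C₁) : p i ∉ U := by
    intro h
    by_cases hiA : i ∈ A
    · exact (hpC ⟨i, ⟨hiA, hi⟩, rfl⟩).2 h
    · exact hiA (hp i hiA ▸ h.1.1)
  obtain ⟨q, hq, hqC⟩ := exists_perm_image_subset (A := A') (P := p '' C₁ ∩ A') (Q := C₀)
    Set.inter_subset_right (fun i hi => (hC₀ hi).2)
    (hcard'.trans (mk_le_mk_of_subset fun i hi => ⟨hi.1.2, fun h => by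
      obtain ⟨j, hj, rfl⟩ := h.1
      exact hpU j hj hi⟩))
    (hcard'.trans (mk_le_mk_of_subset (Set.sdiff_subset_sdiff_left Set.inter_subset_right))) hcard
  have hqp (i : ι) (hi : i ∈ C₁) : q (p i) ∈ C₀ ∨ p i ∉ A' ∧ q (p i) = p i := by
    by_cases h : p i ∈ A'
    · exact Or.inl (hqC ⟨p i, ⟨⟨i, hi, rfl⟩, h⟩, rfl⟩)
    · exact Or.inr ⟨h, hq _ h⟩
  obtain ⟨r, hr, hrC⟩ := exists_perm_image_subset (A := A) (P := (fun i => q (p i)) '' C₁)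
    (Q := C₀) (by
      rintro _ ⟨i, hi, rfl⟩
      rcases hqp i hi with h | ⟨h, h'⟩
      · exact (hC₀ h).1
      · simp only [h']
        by_cases hiA : i ∈ A
        · exact perm_apply_mem hp hiA
        · rw [hp i hiA] at h
          exact absurd ((hC₁ hi).resolve_left hiA) h)
    (fun i hi => (hC₀ hi).1)
    (hcard'.trans (mk_le_mk_of_subset fun i hi => ⟨hi.1.1, by
      rintro ⟨j, hj, rfl⟩
      rcases hqp j hj with h | ⟨h, h'⟩
      · exact hi.2 h
      · exact h (h' ▸ hi.1.2)⟩)) hAC₀ hcard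
  refine ⟨r * q * p, mul_mem (mul_mem (hA r hr) (hA' q hq)) (hA p hp), fun i hi => ?_, ?_⟩
  · have h₁ : i ∉ A := fun h => hi (Or.inl h)
    have h₂ : i ∉ A' := fun h => hi (Or.inr h)
    simp only [Equiv.Perm.mul_apply, hp i h₁, hq i h₂, hr i h₁]
  · rintro _ ⟨i, hi, rfl⟩
    exact hrC ⟨_, ⟨i, hi, rfl⟩, rfl⟩

/-- The involution of `W ⊕ (W × W ⊕ W)` that exchanges each `x` with `(x, h x)`. -/
def graphSwap {W : Type*} [DecidableEq W] (h : W → W) : Equiv.Perm (W ⊕ (W × W ⊕ W)) :=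
  Function.Involutive.toPerm
    (fun
      | .inl x => .inr (.inl (x, h x))
      | .inr (.inl y) => if y.2 = h y.1 then .inl y.1 else .inr (.inl y)
      | .inr (.inr z) => .inr (.inr z))
    (by
      rintro (x | ⟨y, y'⟩ | z)
      · simp
      · by_cases hy : y' = h y
        · simp [hy]
        · simp [hy]
      · rfl)

/-- If the permutations fall into few cosets of `H`, some `s ∈ H` moves almost all elements outside
`C` into `C`, and fixes many elements of `C`. -/
theorem exists_mem_moving_compl (hι : ℵ₀ ≤ #ι) {H : Subgroup (Equiv.Perm ι)}
    (φ : Equiv.Perm ι → ι) (hφ : ∀ π ρ, φ π = φ ρ → π⁻¹ * ρ ∈ H) {C : Set ι} (hC : #ι ≤ #C)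
    (hC' : #ι ≤ #↥Cᶜ) :
    ∃ D : Set ι, Disjoint D C ∧ #D < #ι ∧ ∃ s ∈ H, (∀ i ∉ C, i ∉ D → s i ∈ C) ∧
      #ι ≤ #{i | i ∈ C ∧ s i = i} := by
  classical
  -- In an initial ordinal every proper initial segment is small, so the diagonalization needs no
  -- regularity of the cardinal.
  let W := (#ι).ord.ToType
  have hW : #W = #ι := mk_ord_toType _
  have hIio (x : W) : #(Set.Iio x) < #ι :=
    (mk_Iio_lt x (by rw [hW, Ordinal.type_toType])).trans_eq hW
  obtain ⟨w⟩ : Nonempty (ι ≃ W) := Cardinal.eq.1 hW.symm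
  obtain ⟨e⟩ : Nonempty (W ≃ ↥Cᶜ) := Cardinal.eq.1 (hW.trans (hC'.antisymm (mk_set_le _)))
  -- The summand `W × W` holds the graphs of all functions; the extra `W` is fixed by every swap and
  -- provides the fixed points.
  obtain ⟨c⟩ : Nonempty (W × W ⊕ W ≃ C) := Cardinal.eq.1 (by
    rw [← (hC.antisymm (mk_set_le _)), mk_sum, mk_prod]
    simp only [lift_id, hW, mul_eq_self hι, add_eq_self hι])
  let Φ : W ⊕ (W × W ⊕ W) ≃ ι :=
    (e.sumCongr c).trans ((Equiv.sumComm _ _).trans (Equiv.Set.sumCompl C))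
  have hΦl (x : W) : Φ (.inl x) ∉ C := (e x).2
  have hΦr (y : W × W ⊕ W) : Φ (.inr y) ∈ C := (c y).2
  let γ (h : W → W) : Equiv.Perm ι := Φ.permCongr (graphSwap h)
  have hγ (h : W → W) (z : W ⊕ (W × W ⊕ W)) : γ h (Φ z) = Φ (graphSwap h z) := by
    simp [γ, Equiv.permCongr_apply]
  have hγinv (h : W → W) : (γ h)⁻¹ = γ h := rfl
  -- `g i` represents the coset labelled `i`; `id` is a junk value for unused labels.
  let g (i : W) : W → W := if hi : ∃ h, w (φ (γ h)) = i then hi.choose else id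
  have hg (h : W → W) : φ (γ h) = φ (γ (g (w (φ (γ h))))) := by
    have hi : ∃ h', w (φ (γ h')) = w (φ (γ h)) := ⟨h, rfl⟩
    have := hi.choose_spec
    simp only [g, dif_pos hi]
    exact (w.injective this).symm
  have hdiag (x : W) : ∃ y, y ∉ (fun i => g i x) '' Set.Iio x := by
    by_contra! h
    have h₁ : #W ≤ #((fun i => g i x) '' Set.Iio x) := by
      rw [← mk_univ]; exact mk_le_mk_of_subset fun y _ => h y
    exact (h₁.trans mk_image_le).not_gt ((hIio x).trans_eq hW.symm)
  choose h hh using hdiag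
  set i₀ := w (φ (γ h)) with hi₀
  have hs (z : W ⊕ (W × W ⊕ W)) :
      ((γ h)⁻¹ * γ (g i₀)) (Φ z) = Φ (graphSwap h (graphSwap (g i₀) z)) := by
    rw [hγinv, Equiv.Perm.mul_apply, hγ, hγ]
  -- `h x` avoids `g i x` only for `i < x`, so `i₀` itself is an exception too. For `x > i₀` the
  -- first swap sends `x` to `(x, g i₀ x)`, off the graph of `h`, and the second leaves it in `C`.
  refine ⟨(fun x => Φ (.inl x)) '' Set.Iic i₀, ?_, ?_, (γ h)⁻¹ * γ (g i₀), hφ _ _ (hg h), ?_, ?_⟩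
  · rw [Set.disjoint_left]
    rintro _ ⟨x, -, rfl⟩
    exact hΦl x
  · refine mk_image_le.trans_lt ?_
    rw [← Set.Iio_insert]
    exact mk_insert_le.trans_lt (add_lt_of_lt hι (hIio _) (one_lt_aleph0.trans_le hι))
  · intro i hi hiD
    obtain ⟨x | y, rfl⟩ := Φ.surjective i
    · have hx : i₀ < x := not_le.1 fun hx => hiD ⟨x, hx, rfl⟩
      have hne : g i₀ x ≠ h x := fun e => hh x ⟨i₀, hx, e⟩
      rw [hs, show graphSwap h (graphSwap (g i₀) (.inl x)) = .inr (.inl (x, g i₀ x)) from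
        if_neg hne]
      exact hΦr _
    · exact absurd (hΦr y) hi
  · rw [← hW, ← mk_range_eq (fun x : W => Φ (.inr (.inr x))) fun x y h => by simpa using h]
    refine mk_le_mk_of_subset ?_
    rintro _ ⟨x, rfl⟩
    exact ⟨hΦr _, hs _⟩

end Permutations

/-! ### Assembly: the small exceptional set -/

theorem le_mk_of_subset_union {α : Type w} {c : Cardinal.{w}} (hc : ℵ₀ ≤ c) {r s t : Set α}
    (hr : c ≤ #r) (h : r ⊆ s ∪ t) (ht : #t < c) : c ≤ #s := by
  by_contra! hs
  exact ((hr.trans (mk_le_mk_of_subset h)).trans (mk_union_le s t)).not_gt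
    (add_lt_of_lt hc hs ht)

theorem IsMoiety.le_mk {α : Type w} {c : Cardinal.{w}} (hc : ℵ₀ ≤ c) {I J : Set α}
    (h : IsMoiety J I) (hI : c ≤ #I) : c ≤ #J := by
  by_contra! hJ
  exact hJ.not_ge (le_mk_of_subset_union hc hI
    (by rw [Set.union_sdiff_self]; exact Set.subset_union_right) (h.2 ▸ hJ))

/-- A subgroup of small index contains, for some small set `D` of basis elements, all automorphisms
over `D` that are supported in a set with large complement. -/
theorem IsBasis.exists_small_support {L : FirstOrder.Language.{u, v}} {F : Type w} [L.Structure F]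
    {ι : Type w} {b : ι → F} (hb : IsBasis L b) (hι : ℵ₀ ≤ #ι) (S : Subgroup (F ≃[L] F))
    (hS : #((F ≃[L] F) ⧸ S) ≤ #ι) :
    ∃ D : Set ι, #D < #ι ∧ ∀ C : Set ι, C ⊆ Dᶜ → #ι ≤ #(Dᶜ \ C : Set ι) →
      supportedAut L b D C ≤ S := by
  obtain ⟨P, hP⟩ := hb.exists_permHom
  -- Only permutations supported in `A` are used, so no parameters are needed yet.
  obtain ⟨A, -, hA, hAc, hAS⟩ := hb.exists_supportedAut_le hι S hS (D := ∅) (Y := Set.univ)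
    (Set.disjoint_empty _) mk_univ.ge
  have hAH (π : Equiv.Perm ι) (hπ : ∀ i ∉ A, π i = i) : π ∈ S.comap P :=
    hAS (permHom_mem_supportedAut hP hπ)
  obtain ⟨f⟩ := id hS
  obtain ⟨D, hDA, hD, s, hs, hsA, hfix⟩ := exists_mem_moving_compl hι (H := S.comap P)
    (fun π => f (P π)) (fun π ρ h => by
      rw [Subgroup.mem_comap, map_mul, map_inv]
      exact QuotientGroup.eq.1 (f.injective h)) hA (by rwa [Set.compl_eq_univ_sdiff])
  -- Conjugation by `s` carries permutations supported in `A'` to ones supported in `A`. The fixed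
  -- points of `s` in `A` make `A ∩ A'` large.
  let A' : Set ι := s ⁻¹' A \ D
  have hAH' (π : Equiv.Perm ι) (hπ : ∀ i ∉ A', π i = i) : π ∈ S.comap P := by
    have h : s * π * s⁻¹ ∈ S.comap P := by
      refine hAH _ fun i hi => ?_
      have hsi : s (s⁻¹ i) = i := s.apply_symm_apply i
      rw [Equiv.Perm.mul_apply, Equiv.Perm.mul_apply, hπ _ fun h => hi (hsi ▸ h.1), hsi]
    have := mul_mem (mul_mem (inv_mem hs) h) hs
    rwa [show s⁻¹ * (s * π * s⁻¹) * s = π by group] at this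
  have hU : #ι ≤ #(A ∩ A' : Set ι) := hfix.trans (mk_le_mk_of_subset fun i hi =>
    ⟨hi.1, by simpa [hi.2] using hi.1, hDA.notMem_of_mem_right hi.1⟩)
  have hX : A ∪ A' = Dᶜ := by
    ext i
    refine ⟨fun h => h.elim (fun h => hDA.notMem_of_mem_right h) fun h => h.2, fun h => ?_⟩
    by_cases hi : i ∈ A
    · exact Or.inl hi
    · exact Or.inr ⟨hsA i hi h, h⟩
  obtain ⟨C₀, hC₀, hcard, hcard', hC₀S⟩ := hb.exists_supportedAut_le hι S hS (D := D)
    (hDA.symm.mono_left Set.inter_subset_left) hU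
  refine ⟨D, hD, fun C hC hCc σ hσ => ?_⟩
  obtain ⟨π, hπH, hπ, hπC⟩ : ∃ π ∈ S.comap P, (∀ i ∉ A ∪ A', π i = i) ∧ π '' C ⊆ C₀ := by
    -- The complement of `C` in `A ∪ A'` is large, so it is large in `A` or in `A'`, whose roles are
    -- symmetric.
    by_cases h : #ι ≤ #(A \ C : Set ι)
    · exact exists_perm_mem_image_subset hAH hAH' hC₀ hcard hcard' (hX ▸ hC) h
    · have h' : #ι ≤ #(A' \ C : Set ι) := le_mk_of_subset_union hι hCc
        (by rw [← hX, Set.union_sdiff_distrib, Set.union_comm]) (not_le.1 h)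
      rw [Set.union_comm]
      rw [Set.inter_comm] at hC₀ hcard'
      exact exists_perm_mem_image_subset hAH' hAH hC₀ hcard hcard'
        (by rwa [Set.union_comm, hX]) h'
  have := hC₀S (supportedAut_mono hπC (permHom_conj_mem hP
    (fun i hi => hπ i fun h => (hX ▸ h : i ∈ Dᶜ) hi) hσ))
  have := mul_mem (mul_mem (inv_mem (Subgroup.mem_comap.1 hπH)) this) (Subgroup.mem_comap.1 hπH)
  rwa [show (P π)⁻¹ * (P π * σ * (P π)⁻¹) * P π = σ by group] at this

end RelFree

/-! ### From supports to moietous automorphisms -/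

theorem mainTheorem2 {L : FirstOrder.Language.{u, v}} [L.IsAlgebraic]
    {F : Type w} [L.Structure F] (κ : Cardinal.{w}) (hκ : ℵ₀ ≤ κ)
    (B : Set F) (hB : RelFree.IsRelativelyFreeOn L F B) (hrank : #B = κ)
    (S : Subgroup (F ≃[L] F)) (hindex : #((F ≃[L] F) ⧸ S) ≤ κ) :
    ∃ D : Set F, D ⊆ B ∧ #D < κ ∧
      (∀ σ : F ≃[L] F, RelFree.IsMoietous B σ → (∀ d ∈ D, σ d = d) → σ ∈ S) ∧
      (∀ C : Set F, RelFree.IsMoiety C (B \ D) →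
        RelFree.stab (B \ C) (FirstOrder.Language.Substructure.closure L C : Set F) ≤ S) := by
  open RelFree FirstOrder.Language in
  obtain ⟨E, hE⟩ := hB
  subst hrank
  have hb := hE.isBasis
  obtain ⟨D, hD, hDS⟩ := hb.exists_small_support hκ S hindex
  have hD' : #((↑) '' D : Set F) < #B := mk_image_le.trans_lt hD
  have main (σ : F ≃[L] F) (hσ : IsMoietous B σ) (hσD : ∀ d ∈ ((↑) '' D : Set F), σ d = d) :
      σ ∈ S := by
    obtain ⟨B₁, B₂, hun, hdisj, hB₁, -, hσ⟩ := hσ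
    obtain ⟨hfix, hpres⟩ := Subgroup.mem_inf.1 hσ
    rw [mem_fixingSubgroup_iff] at hfix
    have hfixD (i : B) (hi : i ∈ D) : σ i = i := hσD _ ⟨i, hi, rfl⟩
    -- `B₂` may meet `D`, and removing `D` can destroy invariance of the span of `B₂`; allowing
    -- values in the span of `C ∪ D` absorbs this.
    let C : Set B := {i | i.1 ∈ B₂ ∧ i ∉ D}
    have hle : Substructure.closure L B₂ ≤ span L ((↑) : B → F) (C ∪ D) := by
      refine Substructure.closure_mono fun x hx => ?_
      refine ⟨⟨x, hun ▸ Or.inr hx⟩, ?_, rfl⟩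
      by_cases h : (⟨x, hun ▸ Or.inr hx⟩ : B) ∈ D
      exacts [Or.inr h, Or.inl ⟨hx, h⟩]
    have hmem (τ : F ≃[L] F)
        (hτ : τ ∈ MulAction.stabilizer (F ≃[L] F) (Substructure.closure L B₂ : Set F)) (i : B)
        (hi : i ∈ C) : τ i ∈ span L ((↑) : B → F) (C ∪ D) := by
      have hs : τ • (Substructure.closure L B₂ : Set F) = Substructure.closure L B₂ :=
        MulAction.mem_stabilizer_iff.1 hτ
      exact hle (hs.subset (Set.smul_mem_smul_set (a := τ) (Substructure.subset_closure hi.1)))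
    refine hDS C (fun i hi => hi.2) ?_
      (mem_supportedAut_of (fun i hi => ?_) (hmem σ hpres) (hmem σ⁻¹ (inv_mem hpres)))
    · have h₁ : #B ≤ #((↑) ⁻¹' B₁ : Set B) := by
        rw [mk_preimage_of_injective_of_subset_range _ _ Subtype.val_injective
          (by rw [Subtype.range_coe]; exact hB₁.1)]
        exact hB₁.le_mk hκ le_rfl
      refine le_mk_of_subset_union hκ h₁ (t := D) (fun i hi => ?_) hD
      by_cases h : i ∈ D
      · exact Or.inr h
      · exact Or.inl ⟨h, fun h' => hdisj.notMem_of_mem_left hi h'.1⟩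
    · by_cases h : i ∈ D
      · exact hfixD i h
      · have hi' : i.1 ∈ B₁ ∪ B₂ := hun ▸ i.2
        exact hfix _ (hi'.resolve_right fun h' => hi ⟨h', h⟩)
  refine ⟨(↑) '' D, by rintro _ ⟨i, -, rfl⟩; exact i.2, hD', main, fun C hC σ hσ => ?_⟩
  have hCB : C ⊆ B := hC.1.trans Set.sdiff_subset
  -- Removing fewer than κ elements leaves κ of them, so a moiety of `B \ D` is a moiety of `B`.
  have hBD : #B ≤ #(B \ ((↑) '' D) : Set F) :=
    le_mk_of_subset_union hκ le_rfl (by rw [Set.sdiff_union_self]; exact Set.subset_union_left) hD'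
  have hCcard : #B ≤ #C := hC.le_mk hκ hBD
  have hCcard' : #B ≤ #(B \ C : Set F) := hCcard.trans (hC.2.le.trans
    (mk_le_mk_of_subset (Set.sdiff_subset_sdiff_left Set.sdiff_subset)))
  have heq : #C = #(B \ C : Set F) := ((mk_le_mk_of_subset hCB).antisymm hCcard).trans
    ((mk_le_mk_of_subset Set.sdiff_subset).antisymm hCcard').symm
  refine main σ ⟨B \ C, C, Set.sdiff_union_of_subset hCB, Set.disjoint_sdiff_left,
    ⟨Set.sdiff_subset, by rw [Set.sdiff_sdiff_cancel_left hCB, heq]⟩, ⟨hCB, heq⟩, hσ⟩ ?_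
  intro d hd
  obtain ⟨i, hi, rfl⟩ := id hd
  exact (mem_fixingSubgroup_iff (M := F ≃[L] F)).1 hσ.1 _ ⟨i.2, fun h => (hC.1 h).2 hd⟩
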